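/- Let $X$ be a countably infinite set and let $b\colon X\times X\to[0,\infty)$ be symmetric, zero on the diagonal, with $\sum_{y}b(x,y)<\infty$ for all $x\in X$ (a graph $(b,0)$ over $X$ without killing term). Assume that the graph is connected, i.e. any two vertices are joined by a path of edges $x\sim y$ (meaning $b(x,y)>0$). For $f\colon X\to\mathbb C$ put $$\tilde Q(f)=\tfrac12\sum_{x,y\in X}b(x,y)|f(x)-f(y)|^2\in[0,\infty],$$ and let $\tilde D_0$ be the closure of the finitely supported functions in $\{f:\tilde Q(f)<\infty\}$ with respect to the norm $(\tilde Q(f)+|f(o)|^2)^{1/2}$, where $o\in X$ (by connectedness, $\tilde D_0$ does not depend on $o$). Assume that the graph is uniformly transient, i.e. there is $C>0$ with $\|f\|_\infty^2\le C\,\tilde Q(f)$ for all $f\in\tilde D_0$. For a measure $m$ on $X$ with $0<m(\{x\})<\infty$ for every $x\in X$, let $Q^{(D)}_m$ be the closure in $\ell^2(X,m)$ of the restriction of $\tilde Q$ to the finitely supported functions, and let the Dirichlet Laplacian $L^{(D)}_m$ be its generator, i.e. the positive self-adjoint operator with $L^{(D)}_m f=g$ if and only if $f\in D(Q^{(D)}_m)$,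 $g\in\ell^2(X,m)$ and $Q^{(D)}_m(h,f)=\langle h,g\rangle$ for all $h\in D(Q^{(D)}_m)$. Then for every sequence $(a_k)_{k\ge1}$ of positive numbers there is a probability measure $m$ on $X$, with $m(\{x\})>0$ for every $x\in X$, such that $L^{(D)}_m$ has purely discrete spectrum and its eigenvalues $\lambda_1\le\lambda_2\le\dots$, counted with multiplicity, satisfy $$\frac{\lambda_k}{a_k}\to\infty\qquad(k\to\infty).$$ Hence there is no general upper bound on the eigenvalue growth: there is no sequence $(a_k)$ of positive numbers such that, for every probability measure $m$ on $X$ charging every point for which $L^{(D)}_m$ has purely discrete spectrum, the eigenvalues satisfy $\lambda_k=O(a_k)$. -/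

import Mathlib

open MeasureTheory Filter Topology
open scoped NNReal ENNReal ComplexConjugate InnerProductSpace

/-- A graph `(b, c)` over a set `X`: a symmetric edge weight `b ≥ 0` with zero diagonal and summable
rows, and a killing term `c ≥ 0`. -/
structure WeightedGraph (X : Type*) where
  b : X → X → ℝ≥0
  c : X → ℝ≥0
  symm : ∀ x y, b x y = b y x
  diag : ∀ x, b x x = 0
  summable : ∀ x, Summable (b x)

namespace WeightedGraph

variable {X : Type*} (G : WeightedGraph X)

/-- The combinatorial graph: `x ∼ y` iff `b x y > 0`. -/
def toSimpleGraph : SimpleGraph X where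
  Adj x y := 0 < G.b x y
  symm := ⟨fun x y h => by rw [G.symm y x]; exact h⟩
  loopless := ⟨fun x h => by rw [G.diag x] at h; exact lt_irrefl _ h⟩

/-- A graph is connected if any two vertices are joined by a path. -/
def Connected : Prop := G.toSimpleGraph.Connected

/-- The energy `½ ∑_{x,y} b(x,y) |f(x) - f(y)|² + ∑_x c(x) |f(x)|²` in `[0, ∞]` of a function. -/
noncomputable def energy (f : X → ℂ) : ℝ≥0∞ :=
  2⁻¹ * ∑' p : X × X, (G.b p.1 p.2 : ℝ≥0∞) * ‖f p.1 - f p.2‖ₑ ^ 2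
    + ∑' x, (G.c x : ℝ≥0∞) * ‖f x‖ₑ ^ 2

/-- The sesquilinear form belonging to the energy, conjugate linear in the first argument (the sums
converge absolutely for functions of finite energy). -/
noncomputable def energyForm (f g : X → ℂ) : ℂ :=
  2⁻¹ * ∑' p : X × X, (G.b p.1 p.2 : ℂ) * (conj (f p.1 - f p.2) * (g p.1 - g p.2))
    + ∑' x, (G.c x : ℂ) * (conj (f x) * g x)

/-- The closure of the finitely supported functions in the space of functions of finite energy,
with respect to the norm `(energy f + |f o|²)^{1/2}`. -/
def zeroEnergySpace (o : X) : Set (X → ℂ) :=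
  {f | G.energy f < ⊤ ∧ ∀ ε : ℝ≥0∞, 0 < ε →
    ∃ g : X → ℂ, (Function.support g).Finite ∧ G.energy (f - g) + ‖f o - g o‖ₑ ^ 2 < ε}

/-- Uniform transience (of a connected graph over a countably infinite set, for which the space
`zeroEnergySpace o` does not depend on `o`): `‖f‖_∞² ≤ C · energy f` on that space. -/
def IsUniformlyTransient : Prop :=
  ∃ C : ℝ≥0, 0 < C ∧ ∀ o : X, ∀ f ∈ G.zeroEnergySpace o,
    (⨆ x, ‖f x‖ₑ) ^ 2 ≤ (C : ℝ≥0∞) * G.energy f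

end WeightedGraph

/-- The measure `μ` gives every point a mass in `(0, ∞)`, as the measure of a discrete measure
space does. -/
class HasPositivePointMasses {X : Type*} [MeasurableSpace X] (μ : Measure X) : Prop where
  pos : ∀ x, 0 < μ {x}
  lt_top : ∀ x, μ {x} < ⊤

theorem HasPositivePointMasses.eq_of_ae {X : Type*} [MeasurableSpace X] {μ : Measure X}
    [HasPositivePointMasses μ] {f g : X → ℂ} (h : f =ᵐ[μ] g) : f = g := by
  funext x
  by_contra hx
  have h0 : μ {y | ¬ f y = g y} = 0 := ae_iff.1 h
  have h1 : μ {x} ≤ μ {y | ¬ f y = g y} := measure_mono (by simpa using hx)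
  exact absurd (HasPositivePointMasses.pos (μ := μ) x) (by simp [le_antisymm (h1.trans h0.le)])

namespace WeightedGraph

section Facts

variable {X : Type*} (G : WeightedGraph X)

theorem enorm_add_sq_le (a b : ℂ) : ‖a + b‖ₑ ^ 2 ≤ 2 * ‖a‖ₑ ^ 2 + 2 * ‖b‖ₑ ^ 2 := by
  have h : ‖a + b‖₊ ^ 2 ≤ 2 * ‖a‖₊ ^ 2 + 2 * ‖b‖₊ ^ 2 := by
    rw [← NNReal.coe_le_coe]
    push_cast
    nlinarith [norm_add_le a b, norm_nonneg (a + b), sq_nonneg (‖a‖ - ‖b‖)]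
  simp only [enorm_eq_nnnorm]
  exact_mod_cast h

theorem energy_add_le (f g : X → ℂ) : G.energy (f + g) ≤ 2 * G.energy f + 2 * G.energy g := by
  have h1 : ∑' p : X × X, (G.b p.1 p.2 : ℝ≥0∞) * ‖(f + g) p.1 - (f + g) p.2‖ₑ ^ 2 ≤
      2 * ∑' p : X × X, (G.b p.1 p.2 : ℝ≥0∞) * ‖f p.1 - f p.2‖ₑ ^ 2 +
      2 * ∑' p : X × X, (G.b p.1 p.2 : ℝ≥0∞) * ‖g p.1 - g p.2‖ₑ ^ 2 := by
    rw [← ENNReal.tsum_mul_left, ← ENNReal.tsum_mul_left, ← ENNReal.tsum_add]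
    refine ENNReal.tsum_le_tsum fun p => ?_
    have := enorm_add_sq_le (f p.1 - f p.2) (g p.1 - g p.2)
    rw [show (f + g) p.1 - (f + g) p.2 = (f p.1 - f p.2) + (g p.1 - g p.2) by
      simp only [Pi.add_apply]; ring]
    refine (mul_le_mul_right this _).trans (le_of_eq ?_)
    ring
  have h2 : ∑' x, (G.c x : ℝ≥0∞) * ‖(f + g) x‖ₑ ^ 2 ≤
      2 * ∑' x, (G.c x : ℝ≥0∞) * ‖f x‖ₑ ^ 2 + 2 * ∑' x, (G.c x : ℝ≥0∞) * ‖g x‖ₑ ^ 2 := by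
    rw [← ENNReal.tsum_mul_left, ← ENNReal.tsum_mul_left, ← ENNReal.tsum_add]
    refine ENNReal.tsum_le_tsum fun x => ?_
    refine (mul_le_mul_right (enorm_add_sq_le (f x) (g x)) _).trans (le_of_eq ?_)
    ring
  unfold energy
  refine (add_le_add (mul_le_mul_right h1 _) h2).trans (le_of_eq ?_)
  ring

theorem energy_smul (a : ℂ) (f : X → ℂ) : G.energy (a • f) = ‖a‖ₑ ^ 2 * G.energy f := by
  unfold energy
  simp only [Pi.smul_apply, smul_eq_mul, ← mul_sub, enorm_mul, mul_pow]
  rw [mul_add, ← ENNReal.tsum_mul_left, ← ENNReal.tsum_mul_left, ← ENNReal.tsum_mul_left,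
    ← ENNReal.tsum_mul_left]
  congr 1 <;> exact tsum_congr fun x => by ring

theorem summable_aux {ι : Type*} (w : ι → ℝ≥0) (u v : ι → ℂ)
    (hu : ∑' i, (w i : ℝ≥0∞) * ‖u i‖ₑ ^ 2 ≠ ⊤) (hv : ∑' i, (w i : ℝ≥0∞) * ‖v i‖ₑ ^ 2 ≠ ⊤) :
    Summable fun i => (w i : ℂ) * (conj (u i) * v i) := by
  have key : ∀ z : ι → ℂ, ∑' i, (w i : ℝ≥0∞) * ‖z i‖ₑ ^ 2 ≠ ⊤ →
      Summable fun i => (w i : ℝ) * ‖z i‖ ^ 2 := by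
    intro z hz
    have h : Summable fun i => w i * ‖z i‖₊ ^ 2 := by
      rw [← ENNReal.tsum_coe_ne_top_iff_summable]
      simpa [enorm_eq_nnnorm] using hz
    simpa using NNReal.summable_coe.2 h
  refine Summable.of_norm_bounded ((key u hu).add (key v hv)) fun i => ?_
  simp only [norm_mul, RCLike.norm_conj, Complex.norm_real, NNReal.norm_eq]
  rw [← mul_add]
  refine mul_le_mul_of_nonneg_left ?_ (w i).2
  nlinarith [sq_nonneg (‖u i‖ - ‖v i‖), sq_nonneg (‖u i‖ + ‖v i‖)]

theorem energy_lt_top_iff (f : X → ℂ) : G.energy f < ⊤ ↔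
    ∑' p : X × X, (G.b p.1 p.2 : ℝ≥0∞) * ‖f p.1 - f p.2‖ₑ ^ 2 ≠ ⊤ ∧
      ∑' x, (G.c x : ℝ≥0∞) * ‖f x‖ₑ ^ 2 ≠ ⊤ := by
  unfold energy
  rw [ENNReal.add_lt_top, lt_top_iff_ne_top, lt_top_iff_ne_top, Ne, ENNReal.mul_eq_top]
  simp

theorem energyForm_add {h f g : X → ℂ} (hh : G.energy h < ⊤) (hf : G.energy f < ⊤)
    (hg : G.energy g < ⊤) : G.energyForm h (f + g) = G.energyForm h f + G.energyForm h g := by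
  rw [energy_lt_top_iff] at hh hf hg
  have e1 := (summable_aux _ _ _ hh.1 hf.1).tsum_add (summable_aux _ _ _ hh.1 hg.1)
  have e2 := (summable_aux _ _ _ hh.2 hf.2).tsum_add (summable_aux _ _ _ hh.2 hg.2)
  have e3 : ∑' p : X × X, (G.b p.1 p.2 : ℂ) *
      (conj (h p.1 - h p.2) * ((f + g) p.1 - (f + g) p.2)) = _ :=
    (tsum_congr fun p => by simp only [Pi.add_apply]; ring).trans e1
  have e4 : ∑' x, (G.c x : ℂ) * (conj (h x) * (f + g) x) = _ :=
    (tsum_congr fun p => by simp only [Pi.add_apply]; ring).trans e2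
  unfold energyForm
  rw [e3, e4]
  ring

theorem energyForm_smul (a : ℂ) (h f : X → ℂ) :
    G.energyForm h (a • f) = a * G.energyForm h f := by
  unfold energyForm
  rw [mul_add, ← tsum_mul_left, ← tsum_mul_left, ← tsum_mul_left, ← tsum_mul_left]
  congr 1 <;> exact tsum_congr fun x => by simp only [Pi.smul_apply, smul_eq_mul]; ring

theorem energy_indicator_lt_top (x : X) : G.energy (Set.indicator {x} fun _ => 1) < ⊤ := by
  classical
  rw [energy_lt_top_iff]
  have hb : ∑' y, (G.b x y : ℝ≥0∞) ≠ ⊤ := ENNReal.tsum_coe_ne_top_iff_summable.2 (G.summable x)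
  constructor
  · refine ne_top_of_le_ne_top (b := ∑' y, (G.b x y : ℝ≥0∞) + ∑' y, (G.b x y : ℝ≥0∞))
      (ENNReal.add_ne_top.2 ⟨hb, hb⟩) ?_
    have e1 : ∑' y, (G.b x y : ℝ≥0∞) =
        ∑' p : X × X, if p.1 = x then (G.b p.1 p.2 : ℝ≥0∞) else 0 := by
      symm
      rw [ENNReal.tsum_prod (f := fun y z => if y = x then (G.b y z : ℝ≥0∞) else 0),
        tsum_eq_single x]
      · simp
      · intro y hy; simp [hy]
    have e2 : ∑' y, (G.b x y : ℝ≥0∞) =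
        ∑' p : X × X, if p.2 = x then (G.b p.1 p.2 : ℝ≥0∞) else 0 := by
      rw [ENNReal.tsum_prod (f := fun y z => if z = x then (G.b y z : ℝ≥0∞) else 0)]
      refine tsum_congr fun y => ?_
      rw [tsum_eq_single x]
      · simp [G.symm x y]
      · intro z hz; simp [hz]
    nth_rewrite 1 [e1]
    rw [e2, ← ENNReal.tsum_add]
    refine ENNReal.tsum_le_tsum fun p => ?_
    by_cases h1 : p.1 = x <;> by_cases h2 : p.2 = x <;> simp [h1, h2]
  · rw [tsum_eq_single x]
    · simp
    · intro y hy; simp [hy]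

end Facts

section Dirichlet

variable {X : Type*} [MeasurableSpace X] (G : WeightedGraph X) (μ : Measure X)
  [HasPositivePointMasses μ]

/-- The domain of the Dirichlet form `Q^(D)`, i.e. of the closure in `ℓ²(X, μ)` of the energy on
finitely supported functions: the `ℓ²`-functions of finite energy that are limits of finitely
supported functions in the form norm `(energy f + ‖f‖₂²)^{1/2}`. On it `Q^(D)` is the energy.
Elements of `Lp ℂ 2 μ` are functions here, as every point has positive mass. -/
def dirichletDomain : Submodule ℂ (Lp ℂ 2 μ) where
  carrier := {f | G.energy f < ⊤ ∧ ∀ ε : ℝ≥0∞, 0 < ε →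
    ∃ g : Lp ℂ 2 μ, (Function.support g).Finite ∧ G.energy (f - g : Lp ℂ 2 μ) + ‖f - g‖ₑ ^ 2 < ε}
  zero_mem' := by
    have h0 : ((0 : Lp ℂ 2 μ) : X → ℂ) = 0 :=
      HasPositivePointMasses.eq_of_ae (Lp.coeFn_zero ℂ 2 μ)
    refine ⟨by rw [h0]; simp [energy], fun ε hε => ⟨0, by rw [h0]; simp, ?_⟩⟩
    rw [sub_zero, h0]
    simpa [energy] using hε
  add_mem' := by
    rintro f₁ f₂ ⟨h1, h1'⟩ ⟨h2, h2'⟩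
    have hadd : ∀ u v : Lp ℂ 2 μ, ((u + v : Lp ℂ 2 μ) : X → ℂ) = u + v := fun u v =>
      HasPositivePointMasses.eq_of_ae (Lp.coeFn_add u v)
    refine ⟨?_, fun ε hε => ?_⟩
    · rw [hadd]
      exact (G.energy_add_le _ _).trans_lt (ENNReal.add_lt_top.2
        ⟨ENNReal.mul_lt_top (by simp) h1, ENNReal.mul_lt_top (by simp) h2⟩)
    · have hε4 : 0 < ε / 4 := ENNReal.div_pos hε.ne' (by simp)
      obtain ⟨g₁, s1, e1⟩ := h1' _ hε4
      obtain ⟨g₂, s2, e2⟩ := h2' _ hε4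
      refine ⟨g₁ + g₂, ?_, ?_⟩
      · rw [hadd]
        exact (s1.union s2).subset (Function.support_add _ _)
      · rw [show f₁ + f₂ - (g₁ + g₂) = (f₁ - g₁) + (f₂ - g₂) by abel]
        have hn : ‖(f₁ - g₁) + (f₂ - g₂)‖ₑ ^ 2 ≤ 2 * ‖f₁ - g₁‖ₑ ^ 2 + 2 * ‖f₂ - g₂‖ₑ ^ 2 := by
          have h : ‖(f₁ - g₁) + (f₂ - g₂)‖₊ ^ 2 ≤ 2 * ‖f₁ - g₁‖₊ ^ 2 + 2 * ‖f₂ - g₂‖₊ ^ 2 := by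
            rw [← NNReal.coe_le_coe]
            push_cast
            nlinarith [norm_add_le (f₁ - g₁) (f₂ - g₂), norm_nonneg ((f₁ - g₁) + (f₂ - g₂)),
              sq_nonneg (‖f₁ - g₁‖ - ‖f₂ - g₂‖)]
          simp only [enorm_eq_nnnorm]
          exact_mod_cast h
        have he := G.energy_add_le (f₁ - g₁ : Lp ℂ 2 μ) (f₂ - g₂ : Lp ℂ 2 μ)
        rw [← hadd] at he
        have h2 : ∀ {s : ℝ≥0∞}, s < ε / 4 → 2 * s < ε / 2 := by
          intro s hs
          have := ENNReal.mul_lt_mul_right (a := 2) (by simp) (by simp) hs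
          refine this.trans_le (le_of_eq ?_)
          rw [show (4 : ℝ≥0∞) = 2 * 2 by norm_num, div_eq_mul_inv, div_eq_mul_inv,
            ENNReal.mul_inv (by simp) (by simp), mul_left_comm, ← mul_assoc 2,
            ENNReal.mul_inv_cancel (by simp) (by simp), one_mul]
        refine (add_le_add he hn).trans_lt ?_
        calc _ = 2 * (G.energy (f₁ - g₁ : Lp ℂ 2 μ) + ‖f₁ - g₁‖ₑ ^ 2) +
              2 * (G.energy (f₂ - g₂ : Lp ℂ 2 μ) + ‖f₂ - g₂‖ₑ ^ 2) := by ring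
          _ < ε / 2 + ε / 2 := ENNReal.add_lt_add (h2 e1) (h2 e2)
          _ = ε := ENNReal.add_halves ε
  smul_mem' := by
    rintro a f ⟨h1, h1'⟩
    have hsmul : ∀ u : Lp ℂ 2 μ, ((a • u : Lp ℂ 2 μ) : X → ℂ) = a • (u : X → ℂ) := fun u =>
      HasPositivePointMasses.eq_of_ae (Lp.coeFn_smul a u)
    refine ⟨?_, fun ε hε => ?_⟩
    · rw [hsmul, energy_smul]
      exact ENNReal.mul_lt_top (by finiteness) h1
    · have hpos : 0 < ε / (‖a‖ₑ ^ 2 + 1) := ENNReal.div_pos hε.ne' (by finiteness)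
      obtain ⟨g, s, e⟩ := h1' _ hpos
      refine ⟨a • g, ?_, ?_⟩
      · rw [hsmul]
        exact s.subset (Function.support_const_smul_subset a _)
      · rw [← smul_sub, hsmul, energy_smul, enorm_smul, mul_pow, ← mul_add]
        rw [ENNReal.lt_div_iff_mul_lt (by simp) (by simp)] at e
        refine lt_of_le_of_lt ?_ e
        rw [mul_comm]
        gcongr
        exact le_self_add

/-- The graph of the generator of `Q^(D)`: the pairs `(f, g)` with `f ∈ D(Q^(D))`, `g ∈ ℓ²(X, μ)`
and `Q^(D)(h, f) = ⟨h, g⟩` for all `h ∈ D(Q^(D))`. -/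
noncomputable def dirichletLaplacianGraph : Submodule ℂ (Lp ℂ 2 μ × Lp ℂ 2 μ) where
  carrier := {p | p.1 ∈ G.dirichletDomain μ ∧
    ∀ h ∈ G.dirichletDomain μ, G.energyForm h p.1 = ⟪h, p.2⟫_ℂ}
  zero_mem' := by
    refine ⟨Submodule.zero_mem _, fun h _ => ?_⟩
    have h0 : ((0 : Lp ℂ 2 μ) : X → ℂ) = 0 :=
      HasPositivePointMasses.eq_of_ae (Lp.coeFn_zero ℂ 2 μ)
    change G.energyForm h ((0 : Lp ℂ 2 μ) : X → ℂ) = ⟪h, (0 : Lp ℂ 2 μ)⟫_ℂ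
    rw [h0, inner_zero_right]
    simp [energyForm]
  add_mem' := by
    rintro p q ⟨hp, hp'⟩ ⟨hq, hq'⟩
    refine ⟨Submodule.add_mem _ hp hq, fun h hh => ?_⟩
    rw [Prod.fst_add, Prod.snd_add, inner_add_right, ← hp' h hh, ← hq' h hh,
      HasPositivePointMasses.eq_of_ae (Lp.coeFn_add p.1 q.1)]
    exact G.energyForm_add hh.1 hp.1 hq.1
  smul_mem' := by
    rintro a p ⟨hp, hp'⟩
    refine ⟨Submodule.smul_mem _ a hp, fun h hh => ?_⟩
    rw [Prod.smul_fst, Prod.smul_snd, inner_smul_right, ← hp' h hh,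
      HasPositivePointMasses.eq_of_ae (Lp.coeFn_smul a p.1)]
    exact G.energyForm_smul a _ _

/-- The Dirichlet Laplacian `L^(D)`, the generator of the Dirichlet form `Q^(D)`, as an unbounded
operator in `ℓ²(X, μ)`. -/
noncomputable def dirichletLaplacian : Lp ℂ 2 μ →ₗ.[ℂ] Lp ℂ 2 μ :=
  (G.dirichletLaplacianGraph μ).toLinearPMap

/-- `dirichletLaplacianGraph` is the graph of an operator, namely of `dirichletLaplacian`. -/
theorem dirichletLaplacian_graph [DiscreteMeasurableSpace X] :
    (G.dirichletLaplacian μ).graph = G.dirichletLaplacianGraph μ := by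
  refine Submodule.toLinearPMap_graph_eq _ ?_
  rintro ⟨f, g⟩ ⟨-, hg⟩ (rfl : f = 0)
  have h0 : ((0 : Lp ℂ 2 μ) : X → ℂ) = 0 :=
    HasPositivePointMasses.eq_of_ae (Lp.coeFn_zero ℂ 2 μ)
  refine Lp.ext (Eventually.of_forall fun x => ?_)
  rw [h0]
  have hx := (HasPositivePointMasses.lt_top (μ := μ) x).ne
  set e := indicatorConstLp (μ := μ) 2 (measurableSet_singleton x) hx (1 : ℂ) with he
  have hcoe : (e : X → ℂ) = Set.indicator {x} fun _ => 1 :=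
    HasPositivePointMasses.eq_of_ae indicatorConstLp_coeFn
  have hmem : e ∈ G.dirichletDomain μ := by
    refine ⟨by rw [hcoe]; exact G.energy_indicator_lt_top x, fun ε hε => ⟨e, ?_, ?_⟩⟩
    · rw [hcoe]
      exact (Set.finite_singleton x).subset Set.support_indicator_subset
    · rw [sub_self, h0]
      simpa [energy] using hε
  have h1 := hg e hmem
  simp only [h0] at h1
  rw [he, L2.inner_indicatorConstLp_one, integral_singleton] at h1
  have h2 : μ.real {x} ≠ 0 :=
    (ENNReal.toReal_pos (HasPositivePointMasses.pos x).ne' hx).ne'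
  have h3 : μ.real {x} • g x = 0 := by rw [← h1]; simp [energyForm]
  simpa [h2] using h3

end Dirichlet

end WeightedGraph

/-- The self-adjoint operator `L` has purely discrete spectrum and `ev 0 ≤ ev 1 ≤ …` are its
eigenvalues counted with multiplicity: there is an orthonormal basis of eigenvectors with these
eigenvalues, and `ev k → ∞`. -/
structure IsEigenvalueSequence {H : Type*} [NormedAddCommGroup H] [InnerProductSpace ℂ H]
    (L : H →ₗ.[ℂ] H) (ev : ℕ → ℝ) : Prop where
  monotone : Monotone ev
  tendsto : Tendsto ev atTop atTop
  exists_basis : ∃ φ : HilbertBasis ℕ ℂ H, ∀ k, ∃ hk : φ k ∈ L.domain,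
    L ⟨φ k, hk⟩ = (ev k : ℂ) • φ k

/-! The eigenvalue bound is a dimension count. Among combinations of `k + 1` orthonormal
eigenfunctions there is a nonzero `f` vanishing on a given set `F` of `k` points. Uniform
transience, together with the support of `f`, gives `‖f‖² ≤ μ(Fᶜ) ‖f‖_∞² ≤ C μ(Fᶜ) Q(f) ≤ C μ(Fᶜ) λ
‖f‖²`, where `λ` is the largest eigenvalue involved. Hence `λ ≥ 1 / (C μ(Fᶜ))`
(`SupNormBound.one_le_of_orthonormal`). The constant `C` does not depend on the measure, so a
probability measure with rapidly decaying tails forces the eigenvalues to grow as fast as desired.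

Discreteness of the spectrum uses the same two estimates. Let `J` embed the form domain, with its
form norm, into `ℓ²`. Then `J J*` is the resolvent `(1 + L)⁻¹` (`dirichletResolvent_mem_graph`), and
truncation to `F` changes `J` by at most `(C μ(Fᶜ))^{1/2}` in norm. For a finite measure this tends
to `0`, so `J` is a norm limit of finite rank operators. The spectral theorem for the compact
self-adjoint operator `J J*` gives an eigenbasis, and the eigenvalue bound shows that only finitely
many eigenvalues lie below any level. -/

/-- A function supported in `s` has `ℓ²`-norm at most `μ(s)^{1/2}` times its supremum norm. -/
theorem MeasureTheory.Lp.enorm_sq_le_of_support {X : Type*} [MeasurableSpace X]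
    [DiscreteMeasurableSpace X] {μ : Measure X} {f : Lp ℂ 2 μ} {s : Set X} (hf : ∀ x ∉ s, f x = 0) :
    ‖f‖ₑ ^ 2 ≤ μ s * (⨆ x, ‖f x‖ₑ) ^ 2 := by
  have h1 : (f : X → ℂ) = s.indicator f := by
    funext x
    by_cases hx : x ∈ s
    · simp [hx]
    · simp [hx, hf x hx]
  have h2 : ‖f‖ₑ ≤ (⨆ x, ‖f x‖ₑ) * μ s ^ (2⁻¹ : ℝ) := by
    rw [Lp.enorm_def, h1, eLpNorm_indicator_eq_eLpNorm_restrict (MeasurableSet.of_discrete), ← h1]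
    have := eLpNorm_le_of_ae_enorm_bound (p := 2) (μ := μ.restrict s) (f := f)
      (C := ⨆ x, ‖f x‖ₑ) (Eventually.of_forall fun x => le_iSup (fun x => ‖f x‖ₑ) x)
    simpa using this
  refine (pow_le_pow_left₀ zero_le h2 2).trans (le_of_eq ?_)
  rw [mul_pow, mul_comm, ← ENNReal.rpow_natCast (μ s ^ (2⁻¹ : ℝ)), ← ENNReal.rpow_mul]
  norm_num

/-! ### Point evaluations and point indicators in `ℓ²(X, μ)`. -/

namespace HasPositivePointMasses

variable {X : Type*} [MeasurableSpace X] {μ : Measure X} [HasPositivePointMasses μ]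

theorem coe_zero : ((0 : Lp ℂ 2 μ) : X → ℂ) = 0 := eq_of_ae (Lp.coeFn_zero ℂ 2 μ)

theorem coe_add (f g : Lp ℂ 2 μ) : ((f + g : Lp ℂ 2 μ) : X → ℂ) = f + g :=
  eq_of_ae (Lp.coeFn_add f g)

theorem coe_sub (f g : Lp ℂ 2 μ) : ((f - g : Lp ℂ 2 μ) : X → ℂ) = f - g :=
  eq_of_ae (Lp.coeFn_sub f g)

theorem coe_smul (a : ℂ) (f : Lp ℂ 2 μ) : ((a • f : Lp ℂ 2 μ) : X → ℂ) = a • (f : X → ℂ) :=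
  eq_of_ae (Lp.coeFn_smul a f)

/-- Evaluation at a point, as a linear map on `ℓ²(X, μ)`. -/
noncomputable def evalₗ (x : X) : Lp ℂ 2 μ →ₗ[ℂ] ℂ where
  toFun f := f x
  map_add' f g := by rw [coe_add]; rfl
  map_smul' a f := by rw [coe_smul]; rfl

@[simp] theorem evalₗ_apply (x : X) (f : Lp ℂ 2 μ) : evalₗ x f = f x := rfl

theorem coe_sum {ι : Type*} (s : Finset ι) (f : ι → Lp ℂ 2 μ) (x : X) :
    (∑ i ∈ s, f i : Lp ℂ 2 μ) x = ∑ i ∈ s, f i x :=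
  map_sum (evalₗ x) f s

theorem real_singleton_pos (x : X) : 0 < μ.real {x} :=
  ENNReal.toReal_pos (pos x).ne' (lt_top x).ne

variable [DiscreteMeasurableSpace X]

variable (μ) in
/-- The indicator function of a point, as an element of `ℓ²(X, μ)`. -/
noncomputable def pointIndicator (x : X) : Lp ℂ 2 μ :=
  indicatorConstLp 2 (measurableSet_singleton x) (lt_top (μ := μ) x).ne 1

theorem coe_pointIndicator (x : X) :
    (pointIndicator μ x : X → ℂ) = Set.indicator {x} fun _ => 1 :=
  eq_of_ae indicatorConstLp_coeFn

theorem inner_pointIndicator (x : X) (f : Lp ℂ 2 μ) :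
    ⟪pointIndicator μ x, f⟫_ℂ = μ.real {x} * f x := by
  rw [pointIndicator, L2.inner_indicatorConstLp_one, integral_singleton, Complex.real_smul]

theorem continuous_evalₗ (x : X) : Continuous (evalₗ x : Lp ℂ 2 μ → ℂ) := by
  -- Up to the factor `μ {x}`, evaluation is the inner product with the point indicator, hence
  -- continuous.
  have h : (evalₗ x : Lp ℂ 2 μ → ℂ) =
      fun f => ((μ.real {x} : ℝ) : ℂ)⁻¹ * ⟪pointIndicator μ x, f⟫_ℂ := by
    funext f
    have := (real_singleton_pos (μ := μ) x).ne'
    rw [inner_pointIndicator, evalₗ_apply, inv_mul_cancel_left₀ (by exact_mod_cast this)]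
  rw [h]
  fun_prop

/-- Evaluation at a point, as a continuous linear functional on `ℓ²(X, μ)`. -/
noncomputable def evalCLM (x : X) : Lp ℂ 2 μ →L[ℂ] ℂ := ⟨evalₗ x, continuous_evalₗ x⟩

@[simp] theorem evalCLM_apply (x : X) (f : Lp ℂ 2 μ) : evalCLM x f = f x := rfl

end HasPositivePointMasses

/-! ### Lower bounds for eigenvalues from uniform transience. -/

namespace WeightedGraph

open HasPositivePointMasses

variable {X : Type*}

/-- A homogeneous linear system with fewer equations, one for each point of `F`, than unknowns `c
i`. -/
theorem exists_ne_zero_sum_eq_zero {ι : Type*} [Fintype ι] (φ : ι → X → ℂ) (F : Finset X)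
    (hF : F.card < Fintype.card ι) :
    ∃ c : ι → ℂ, c ≠ 0 ∧ ∀ x ∈ F, ∑ i, c i * φ i x = 0 := by
  let T : (ι → ℂ) →ₗ[ℂ] (F → ℂ) :=
    LinearMap.pi fun x => ∑ i, (φ i x) • LinearMap.proj i
  have hT : LinearMap.ker T ≠ ⊥ := LinearMap.ker_ne_bot_of_finrank_lt (by simpa using hF)
  obtain ⟨c, hc, hc0⟩ := (Submodule.ne_bot_iff _).1 hT
  refine ⟨c, hc0, fun x hx => ?_⟩
  have := congrFun (LinearMap.mem_ker.1 hc) ⟨x, hx⟩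
  simpa [T, mul_comm] using this

theorem tsum_conj_mul_self {ι : Type*} (w : ι → ℝ≥0) (u : ι → ℂ) :
    ∑' i, (w i : ℂ) * (conj (u i) * u i) =
      ((∑' i, (w i : ℝ≥0∞) * ‖u i‖ₑ ^ 2).toReal : ℂ) := by
  rw [ENNReal.tsum_toReal_eq (fun i => by finiteness), Complex.ofReal_tsum]
  refine tsum_congr fun i => ?_
  rw [Complex.conj_mul']
  simp

theorem energyForm_self (G : WeightedGraph X) {f : X → ℂ} (hf : G.energy f < ⊤) :
    G.energyForm f f = ((G.energy f).toReal : ℂ) := by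
  have h := (G.energy_lt_top_iff f).1 hf
  have e1 := tsum_conj_mul_self (fun p : X × X => G.b p.1 p.2) fun p => f p.1 - f p.2
  have e2 := tsum_conj_mul_self G.c f
  unfold energyForm energy
  rw [e1, e2, ENNReal.toReal_add (ENNReal.mul_ne_top (by simp) h.1) h.2, ENNReal.toReal_mul]
  simp

/-- The constant `C` is admissible in the definition of uniform transience. -/
def SupNormBound (G : WeightedGraph X) (C : ℝ≥0) : Prop :=
  ∀ o : X, ∀ f ∈ G.zeroEnergySpace o, (⨆ x, ‖f x‖ₑ) ^ 2 ≤ (C : ℝ≥0∞) * G.energy f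

variable [MeasurableSpace X] [DiscreteMeasurableSpace X] {G : WeightedGraph X} {μ : Measure X}
  [HasPositivePointMasses μ]

/-- Evaluation at `o` is bounded on `ℓ²`, so approximation in the form norm implies approximation in
the norm defining `zeroEnergySpace`. This makes the transience estimate available on the form
domain. -/
theorem mem_zeroEnergySpace_of_mem_dirichletDomain {f : Lp ℂ 2 μ} (hf : f ∈ G.dirichletDomain μ)
    (o : X) : (f : X → ℂ) ∈ G.zeroEnergySpace o := by
  refine ⟨hf.1, fun ε hε => ?_⟩
  set M : ℝ≥0∞ := ‖(evalCLM o : Lp ℂ 2 μ →L[ℂ] ℂ)‖ₑ ^ 2 with hM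
  have hMt : M ≠ ⊤ := by finiteness
  obtain ⟨g, hg, hg'⟩ := hf.2 (ε / (M + 1)) (ENNReal.div_pos hε.ne' (by finiteness))
  refine ⟨g, hg, ?_⟩
  rw [ENNReal.lt_div_iff_mul_lt (Or.inl (by simp)) (Or.inl (by finiteness))] at hg'
  refine lt_of_le_of_lt ?_ hg'
  rw [← coe_sub]
  have h1 : ‖f o - g o‖ₑ ^ 2 ≤ M * ‖f - g‖ₑ ^ 2 := by
    rw [← Pi.sub_apply, ← coe_sub, ← evalCLM_apply, hM, ← mul_pow]
    exact pow_le_pow_left₀ zero_le (ContinuousLinearMap.le_opENorm _ _) 2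
  refine (add_le_add_right h1 _).trans ?_
  rw [mul_add, mul_one, add_mul, add_comm]
  have h2 : M * ‖f - g‖ₑ ^ 2 ≤ ‖f - g‖ₑ ^ 2 * M := by rw [mul_comm]
  calc _ ≤ ‖f - g‖ₑ ^ 2 * M + G.energy (f - g : Lp ℂ 2 μ) := by gcongr
    _ ≤ (G.energy (f - g : Lp ℂ 2 μ) * M + ‖f - g‖ₑ ^ 2 * M) +
        (G.energy (f - g : Lp ℂ 2 μ) + ‖f - g‖ₑ ^ 2) := by
      gcongr
      · exact le_add_self
      · exact le_self_add

/-- Uniform transience bounds functions in the form domain. -/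
theorem SupNormBound.iSup_enorm_sq_le {C : ℝ≥0} (hC : G.SupNormBound C) {f : Lp ℂ 2 μ}
    (hf : f ∈ G.dirichletDomain μ) : (⨆ x, ‖f x‖ₑ) ^ 2 ≤ (C : ℝ≥0∞) * G.energy f := by
  rcases isEmpty_or_nonempty X with hX | ⟨⟨o⟩⟩
  · simp
  · exact hC o _ (mem_zeroEnergySpace_of_mem_dirichletDomain hf o)

/-- A lower bound for the largest of more than `#F` eigenvalues. -/
theorem SupNormBound.one_le_of_orthonormal {C : ℝ≥0} (hC : G.SupNormBound C) {ι : Type*}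
    [Fintype ι] {φ : ι → Lp ℂ 2 μ} (hφ : Orthonormal ℂ φ) {ev : ι → ℝ}
    (hev : ∀ i, (φ i, (ev i : ℂ) • φ i) ∈ G.dirichletLaplacianGraph μ) {t : ℝ}
    (ht : ∀ i, ev i ≤ t) (F : Finset X) (hF : F.card < Fintype.card ι) :
    1 ≤ C * ENNReal.ofReal t * μ (F : Set X)ᶜ := by
  obtain ⟨c, hc0, hc⟩ := exists_ne_zero_sum_eq_zero (fun i => (φ i : X → ℂ)) F hF
  -- The test function: it vanishes on `F`, and its Rayleigh quotient is an average of the `ev i`,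
  -- hence at most `t`.
  set f : Lp ℂ 2 μ := ∑ i, c i • φ i with hf
  have hfn : ⟪f, f⟫_ℂ = ∑ i, ((‖c i‖ ^ 2 : ℝ) : ℂ) := by
    rw [hf, hφ.inner_sum]
    exact Finset.sum_congr rfl fun i _ => by rw [Complex.conj_mul']; simp
  have hfn' : ‖f‖ ^ 2 = ∑ i, ‖c i‖ ^ 2 := by
    rw [inner_self_eq_norm_sq_to_K, ← Complex.ofReal_sum] at hfn
    refine Complex.ofReal_injective ?_
    rw [← hfn]
    simp
  have hpos : 0 < ‖f‖ ^ 2 := by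
    rw [hfn']
    obtain ⟨i, hi⟩ := Function.ne_iff.1 hc0
    exact Finset.sum_pos' (fun i _ => by positivity) ⟨i, Finset.mem_univ _, by
      have : 0 < ‖c i‖ := norm_pos_iff.2 hi
      positivity⟩
  have hg : (f, ∑ i, (c i * ev i) • φ i) ∈ G.dirichletLaplacianGraph μ := by
    have := Submodule.sum_mem _ fun i (_ : i ∈ Finset.univ) =>
      Submodule.smul_mem (G.dirichletLaplacianGraph μ) (c i) (hev i)
    convert this
    · simp [hf, Prod.fst_sum]
    · simp [Prod.snd_sum, mul_smul]
  obtain ⟨hfD, hfg⟩ := hg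
  have hE : (G.energy f).toReal ≤ t * ‖f‖ ^ 2 := by
    have h1 := hfg f hfD
    simp only at h1
    rw [energyForm_self G hfD.1, hf, hφ.inner_sum] at h1
    have h2 : ((G.energy f).toReal : ℂ) = ((∑ i, ev i * ‖c i‖ ^ 2 : ℝ) : ℂ) := by
      rw [hf, h1, Complex.ofReal_sum]
      refine Finset.sum_congr rfl fun i _ => ?_
      rw [← mul_assoc, Complex.conj_mul']
      push_cast
      ring
    rw [Complex.ofReal_inj.1 h2, hfn', Finset.mul_sum]
    exact Finset.sum_le_sum fun i _ => by gcongr; exact ht i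
  have hE' : G.energy f ≤ ENNReal.ofReal t * ‖f‖ₑ ^ 2 := by
    rw [← ENNReal.ofReal_toReal hfD.1.ne]
    refine (ENNReal.ofReal_le_ofReal hE).trans (le_of_eq ?_)
    rw [ENNReal.ofReal_mul' hpos.le, ENNReal.ofReal_pow (norm_nonneg _), ofReal_norm]
  have hmain : ‖f‖ₑ ^ 2 ≤ (C * ENNReal.ofReal t * μ (F : Set X)ᶜ) * ‖f‖ₑ ^ 2 := by
    calc ‖f‖ₑ ^ 2 ≤ μ (F : Set X)ᶜ * (⨆ x, ‖f x‖ₑ) ^ 2 := by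
          refine Lp.enorm_sq_le_of_support fun x hx => ?_
          rw [hf, coe_sum, ← hc x (by simpa using hx)]
          exact Finset.sum_congr rfl fun i _ => by rw [coe_smul]; rfl
      _ ≤ μ (F : Set X)ᶜ * (C * (ENNReal.ofReal t * ‖f‖ₑ ^ 2)) := by
          gcongr
          exact (hC.iSup_enorm_sq_le hfD).trans (by gcongr)
      _ = _ := by ring
  have hne : ‖f‖ₑ ^ 2 ≠ 0 := by
    have : f ≠ 0 := by rintro h; simp [h] at hpos
    simpa using this
  rw [← ENNReal.mul_le_mul_iff_left hne (by finiteness), one_mul]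
  exact hmain

end WeightedGraph

/-! ### Enumeration of eigenvalues and bases of eigenvectors. -/

/-- An infinite family of reals with finite sublevel sets can be enumerated in increasing order. -/
theorem exists_equiv_nat_monotone {ι : Type*} [Infinite ι] (v : ι → ℝ)
    (hv : ∀ t, {i | v i ≤ t}.Finite) : ∃ e : ℕ ≃ ι, Monotone (v ∘ e) := by
  classical
  obtain ⟨hlin, -⟩ := exists_wellFoundedLT ι
  -- Equal values are separated by an auxiliary linear order on `ι`, which makes `key` injective.
  let key : ι → ℝ ×ₗ ι := fun i => toLex (v i, i)
  have hkey : ∀ {i j}, key j ≤ key i → v j ≤ v i := fun h => by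
    rcases Prod.Lex.toLex_le_toLex.1 h with h | h
    · exact h.le
    · exact h.1.le
  have hinj : Function.Injective key := fun i j h => (Prod.ext_iff.1 (toLex.injective h)).2
  have hfin : ∀ i, {j | key j < key i}.Finite := fun i =>
    (hv (v i)).subset fun j hj => hkey (le_of_lt hj)
  -- The rank, i.e. the number of predecessors, embeds `ι` as an infinite subset of `ℕ`, and such a
  -- subset has an increasing enumeration.
  let r : ι → ℕ := fun i => {j | key j < key i}.ncard
  have hr : ∀ {i j}, key i < key j → r i < r j := fun {i j} h =>
    Set.ncard_lt_ncard ⟨fun k hk => lt_trans hk h, fun hs => lt_irrefl (key i) (hs h)⟩ (hfin j)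
  have hrinj : Function.Injective r := fun i j h => by
    rcases lt_trichotomy (key i) (key j) with h' | h' | h'
    · exact absurd h (hr h').ne
    · exact hinj h'
    · exact absurd h (hr h').ne'
  have : Infinite (Set.range r) := Set.infinite_coe_iff.2 (Set.infinite_range_of_injective hrinj)
  let o := Nat.Subtype.orderIsoOfNat (Set.range r)
  refine ⟨o.toEquiv.trans (Equiv.ofInjective r hrinj).symm, fun n m hnm => ?_⟩
  set i := (Equiv.ofInjective r hrinj).symm (o n) with hi
  set j := (Equiv.ofInjective r hrinj).symm (o m) with hj
  have hi' : r i = o n := congrArg Subtype.val ((Equiv.ofInjective r hrinj).apply_symm_apply (o n))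
  have hj' : r j = o m := congrArg Subtype.val ((Equiv.ofInjective r hrinj).apply_symm_apply (o m))
  change v i ≤ v j
  refine hkey (not_lt.1 fun h => ?_)
  have h1 := hr h
  rw [hi', hj'] at h1
  exact absurd (o.monotone hnm) (not_le.2 h1)

/-- A Hilbert space has an orthonormal family with dense span. -/
theorem exists_orthonormal_dense_span (H : Type*) [NormedAddCommGroup H]
    [InnerProductSpace ℂ H] [CompleteSpace H] :
    ∃ (w : Set H) (b : w → H), Orthonormal ℂ b ∧
      Dense (Submodule.span ℂ (Set.range b) : Set H) := by
  obtain ⟨w, b, -⟩ := exists_hilbertBasis ℂ H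
  exact ⟨w, b, b.orthonormal, Submodule.dense_iff_topologicalClosure_eq_top.2 b.dense_span⟩

/-- Families with dense span in each of the subspaces `V a` have the same orthogonal complement as
the supremum of the `V a`. -/
theorem orthogonal_span_range_sigma_le {H : Type*} [NormedAddCommGroup H]
    [InnerProductSpace ℂ H] {α : Type*} {V : α → Submodule ℂ H} {w : α → Type*}
    (b : ∀ a, w a → V a) (hd : ∀ a, Dense (Submodule.span ℂ (Set.range (b a)) : Set (V a))) :
    (Submodule.span ℂ (Set.range fun i : Σ a, w a => (b i.1 i.2 : H)))ᗮ ≤ (⨆ a, V a)ᗮ := by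
  rw [← Submodule.iInf_orthogonal]
  intro v hv
  rw [Submodule.mem_iInf]
  intro a
  rw [Submodule.mem_orthogonal']
  intro u hu
  have h0 : (innerSL ℂ v).comp (V a).subtypeL = 0 := by
    refine ContinuousLinearMap.ext_on (hd a) ?_
    rintro _ ⟨i, rfl⟩
    exact (Submodule.mem_orthogonal' _ _).1 hv _ (Submodule.subset_span ⟨⟨a, i⟩, rfl⟩)
  exact DFunLike.congr_fun h0 (⟨u, hu⟩ : V a)

universe u v in
/-- An orthogonal family of complete subspaces with trivial common orthogonal complement has a
Hilbert basis adapted to it. -/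
theorem OrthogonalFamily.exists_hilbertBasis {H : Type u} [NormedAddCommGroup H]
    [InnerProductSpace ℂ H] [CompleteSpace H] {α : Type v} {V : α → Submodule ℂ H}
    [∀ a, CompleteSpace (V a)] (hV : OrthogonalFamily ℂ (fun a => V a) fun a => (V a).subtypeₗᵢ)
    (htot : (⨆ a, V a)ᗮ = ⊥) :
    ∃ (ι : Type max u v) (φ : HilbertBasis ι ℂ H) (κ : ι → α), ∀ i, φ i ∈ V (κ i) := by
  choose w b hb hd using fun a : α => exists_orthonormal_dense_span (V a)
  have hon : Orthonormal ℂ fun i : Σ a, w a => (b i.1 i.2 : H) :=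
    hV.orthonormal_sigma_orthonormal hb
  have hbot := (orthogonal_span_range_sigma_le b hd).trans htot.le
  refine ⟨_, HilbertBasis.mkOfOrthogonalEqBot hon (eq_bot_iff.2 hbot), Sigma.fst, fun i => ?_⟩
  rw [HilbertBasis.coe_mkOfOrthogonalEqBot]
  exact (b i.1 i.2).2

universe u in
/-- A compact self-adjoint operator has a Hilbert basis of eigenvectors. -/
theorem IsCompactOperator.exists_hilbertBasis_eigenvectors {H : Type u} [NormedAddCommGroup H]
    [InnerProductSpace ℂ H] [CompleteSpace H] {T : H →L[ℂ] H} (hT : IsCompactOperator T)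
    (hsymm : T.IsSymmetric) :
    ∃ (ι : Type u) (φ : HilbertBasis ι ℂ H) (κ : ι → ℂ), ∀ i, T (φ i) = κ i • φ i := by
  have hcl (κ : ℂ) : CompleteSpace (Module.End.eigenspace (T : Module.End ℂ H) κ) := by
    have h : (Module.End.eigenspace (T : Module.End ℂ H) κ : Set H) = {v | T v = κ • v} := by
      ext v
      exact Module.End.mem_eigenspace_iff
    have h' : IsClosed (Module.End.eigenspace (T : Module.End ℂ H) κ : Set H) := by
      rw [h]
      exact isClosed_eq T.continuous (continuous_const_smul κ)
    exact h'.completeSpace_coe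
  obtain ⟨ι, φ, κ, h⟩ := OrthogonalFamily.exists_hilbertBasis
    hsymm.orthogonalFamily_eigenspaces
    (ContinuousLinearMap.orthogonalComplement_iSup_eigenspaces_eq_bot hT hsymm)
  exact ⟨ι, φ, κ, fun i => Module.End.mem_eigenspace_iff.1 (h i)⟩

/-! ### Compactness by approximation, and operators of the form `A A*`. -/

namespace ContinuousLinearMap

variable {V H : Type*} [NormedAddCommGroup V] [InnerProductSpace ℂ V]
  [NormedAddCommGroup H] [InnerProductSpace ℂ H]

theorem isCompactOperator_sum_smulRight {ι : Type*} (s : Finset ι) (u : ι → V →L[ℂ] ℂ)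
    (v : ι → H) :
    IsCompactOperator (∑ i ∈ s, (u i).smulRight (v i) : V →L[ℂ] H) := by
  classical
  induction s using Finset.induction_on with
  | empty => exact isCompactOperator_zero
  | insert i s hi ih =>
    rw [Finset.sum_insert hi]
    refine IsCompactOperator.add (f := (u i).smulRight (v i)) ?_ ih
    have h : IsCompactOperator (toSpanSingleton ℂ (v i)) :=
      isCompactOperator_of_locallyCompactSpace_rng (toSpanSingleton ℂ (v i))
    exact h.comp_clm (u i)

variable [CompleteSpace H]

theorem isCompactOperator_of_norm_sub_le {ι : Type*} {l : Filter ι} [l.NeBot]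
    {T : ι → V →L[ℂ] H} {A : V →L[ℂ] H} (hT : ∀ i, IsCompactOperator (T i)) {r : ι → ℝ}
    (hr : Tendsto r l (𝓝 0)) (h : ∀ i, ‖T i - A‖ ≤ r i) : IsCompactOperator A :=
  isCompactOperator_of_tendsto (tendsto_iff_norm_sub_tendsto_zero.2
    (squeeze_zero (fun _ => norm_nonneg _) h hr)) (Eventually.of_forall hT)

variable [CompleteSpace V]

theorem inner_comp_adjoint (A : V →L[ℂ] H) (f g : H) :
    ⟪f, (A.comp (adjoint A)) g⟫_ℂ = ⟪adjoint A f, adjoint A g⟫_ℂ := by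
  rw [comp_apply, adjoint_inner_left]

theorem isSymmetric_comp_adjoint (A : V →L[ℂ] H) : (A.comp (adjoint A)).IsSymmetric :=
  fun f g => by
    change ⟪(A.comp (adjoint A)) f, g⟫_ℂ = ⟪f, (A.comp (adjoint A)) g⟫_ℂ
    rw [← inner_conj_symm, inner_comp_adjoint, inner_comp_adjoint, inner_conj_symm]

/-- Pair the eigenvalue equation with `f`: `κ = ⟪f, A A* f⟫ = ‖A* f‖²`. -/
theorem eigenvalue_comp_adjoint (A : V →L[ℂ] H) {f : H} (hf : ‖f‖ = 1) {κ : ℂ}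
    (hκ : (A.comp (adjoint A)) f = κ • f) : κ = ((‖adjoint A f‖ ^ 2 : ℝ) : ℂ) := by
  have h := inner_comp_adjoint A f f
  rw [hκ, inner_smul_right, inner_self_eq_norm_sq_to_K, inner_self_eq_norm_sq_to_K, hf] at h
  simpa using h

end ContinuousLinearMap

/-- Continuity of a finite measure from above, along the complements of the finite sets, whose
intersection is empty. -/
theorem MeasureTheory.tendsto_measureReal_compl_finset {X : Type*} [MeasurableSpace X]
    [DiscreteMeasurableSpace X] [Countable X] {μ : Measure X} [IsFiniteMeasure μ] :
    Tendsto (fun F : Finset X => μ.real (F : Set X)ᶜ) atTop (𝓝 0) := by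
  have h := tendsto_measure_iInter_atTop (μ := μ) (s := fun F : Finset X => (F : Set X)ᶜ)
    (fun F => MeasurableSet.of_discrete.nullMeasurableSet)
    (fun F F' h => Set.compl_subset_compl.2 (Finset.coe_subset.2 h)) ⟨∅, measure_ne_top _ _⟩
  have h0 : (⋂ F : Finset X, (F : Set X)ᶜ) = ∅ :=
    Set.eq_empty_of_forall_notMem fun x hx => (Set.mem_iInter.1 hx {x}) (by simp)
  rw [h0, measure_empty] at h
  exact (ENNReal.tendsto_toReal ENNReal.zero_ne_top).comp h

/-! ### The form domain as a Hilbert space, and the resolvent. -/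

namespace WeightedGraph

open HasPositivePointMasses

section Gradient

variable {X : Type*} (G : WeightedGraph X)

/-- The weighted differences of a function along the pairs of vertices. -/
noncomputable def grad (f : X → ℂ) (p : X × X) : ℂ :=
  (Real.sqrt (G.b p.1 p.2 / 2) : ℂ) * (f p.1 - f p.2)

theorem grad_add (f g : X → ℂ) : G.grad (f + g) = G.grad f + G.grad g := by
  funext p
  simp only [grad, Pi.add_apply]
  ring

theorem grad_smul (a : ℂ) (f : X → ℂ) : G.grad (a • f) = a • G.grad f := by
  funext p
  simp only [grad, Pi.smul_apply, smul_eq_mul]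
  ring

/-- The weight `√(b/2)` in `grad` is chosen so that the `ℓ²(X × X)` inner product of gradients is
the edge part of the energy form. -/
theorem conj_grad_mul_grad (f g : X → ℂ) (p : X × X) : conj (G.grad f p) * G.grad g p =
    2⁻¹ * ((G.b p.1 p.2 : ℂ) * (conj (f p.1 - f p.2) * (g p.1 - g p.2))) := by
  have h : (Real.sqrt (G.b p.1 p.2 / 2) : ℂ) * (Real.sqrt (G.b p.1 p.2 / 2) : ℂ) =
      2⁻¹ * (G.b p.1 p.2 : ℂ) := by
    rw [← Complex.ofReal_mul, Real.mul_self_sqrt (by positivity)]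
    push_cast
    ring
  simp only [grad, map_mul, Complex.conj_ofReal]
  linear_combination (conj (f p.1 - f p.2) * (g p.1 - g p.2)) * h

variable {G}

theorem energy_eq_tsum_grad (hc : ∀ x, G.c x = 0) (f : X → ℂ) :
    G.energy f = ∑' p, ‖G.grad f p‖ₑ ^ 2 := by
  unfold energy
  simp only [hc, ENNReal.coe_zero, zero_mul, tsum_zero, add_zero]
  rw [← ENNReal.tsum_mul_left]
  refine tsum_congr fun p => ?_
  have h : ‖G.grad f p‖₊ ^ 2 = 2⁻¹ * (G.b p.1 p.2 * ‖f p.1 - f p.2‖₊ ^ 2) := by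
    rw [← NNReal.coe_inj]
    simp only [grad, nnnorm_mul]
    push_cast
    rw [mul_pow, Complex.norm_real, Real.norm_eq_abs, sq_abs, Real.sq_sqrt (by positivity)]
    ring
  simp only [enorm_eq_nnnorm]
  rw [← ENNReal.coe_pow (‖G.grad f p‖₊), h]
  push_cast
  rfl

theorem memℓp_grad (hc : ∀ x, G.c x = 0) {f : X → ℂ} (hf : G.energy f < ⊤) :
    Memℓp (G.grad f) 2 := by
  rw [energy_eq_tsum_grad hc] at hf
  rw [memℓp_gen_iff (by simp)]
  have h : Summable fun p => ‖G.grad f p‖₊ ^ 2 := by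
    rw [← ENNReal.tsum_coe_ne_top_iff_summable]
    simpa [enorm_eq_nnnorm] using hf.ne
  simpa using NNReal.summable_coe.2 h

theorem enorm_sq_eq_energy (hc : ∀ x, G.c x = 0) {f : X → ℂ} {u : lp (fun _ : X × X => ℂ) 2}
    (hu : ⇑u = G.grad f) : ‖u‖ₑ ^ 2 = G.energy f := by
  have h1 := lp.hasSum_norm (p := 2) (by simp) u
  simp only [ENNReal.toReal_ofNat, Real.rpow_ofNat] at h1
  have h2 : HasSum (fun p => ‖u p‖₊ ^ 2) (‖u‖₊ ^ 2) := by
    rw [← NNReal.hasSum_coe]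
    simpa using h1
  rw [energy_eq_tsum_grad hc, ← hu]
  simp only [enorm_eq_nnnorm]
  rw [← ENNReal.coe_pow, ← h2.tsum_eq, ENNReal.coe_tsum h2.summable]
  simp

theorem inner_eq_energyForm (hc : ∀ x, G.c x = 0) {f g : X → ℂ}
    {u v : lp (fun _ : X × X => ℂ) 2} (hu : ⇑u = G.grad f) (hv : ⇑v = G.grad g) :
    ⟪u, v⟫_ℂ = G.energyForm f g := by
  unfold energyForm
  simp only [hc, NNReal.coe_zero, Complex.ofReal_zero, zero_mul, tsum_zero, add_zero]
  rw [lp.inner_eq_tsum, ← tsum_mul_left]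
  refine tsum_congr fun p => ?_
  rw [← conj_grad_mul_grad, hu, hv, RCLike.inner_apply, mul_comm]

end Gradient

variable {X : Type*} [MeasurableSpace X] (G : WeightedGraph X) (μ : Measure X)
  [HasPositivePointMasses μ]

/-- The pairs of a function and its square summable gradient. -/
noncomputable def gradGraph : Submodule ℂ (WithLp 2 (Lp ℂ 2 μ × lp (fun _ : X × X => ℂ) 2)) where
  carrier := {v | ⇑v.snd = G.grad v.fst}
  zero_mem' := by
    change ⇑(0 : lp (fun _ : X × X => ℂ) 2) = G.grad ((0 : Lp ℂ 2 μ) : X → ℂ)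
    rw [coe_zero, lp.coeFn_zero]
    funext p
    simp [grad]
  add_mem' := by
    intro v w hv hw
    change ⇑(v.snd + w.snd) = G.grad ((v.fst + w.fst : Lp ℂ 2 μ) : X → ℂ)
    rw [coe_add, lp.coeFn_add, grad_add]
    exact congrArg₂ _ hv hw
  smul_mem' := by
    intro a v hv
    change ⇑(a • v.snd) = G.grad ((a • v.fst : Lp ℂ 2 μ) : X → ℂ)
    rw [coe_smul, lp.coeFn_smul, grad_smul]
    exact congrArg _ hv

/-- The form domain of `Q^(D)` with the form norm, as a closed subspace of a Hilbert space: the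
closure of the pairs of a finitely supported function and its gradient. -/
noncomputable def formSpace : Submodule ℂ (WithLp 2 (Lp ℂ 2 μ × lp (fun _ : X × X => ℂ) 2)) :=
  Submodule.topologicalClosure
    { carrier := {v | v ∈ G.gradGraph μ ∧ (Function.support v.fst).Finite}
      zero_mem' := ⟨Submodule.zero_mem _, by
        change (Function.support ((0 : Lp ℂ 2 μ) : X → ℂ)).Finite
        rw [coe_zero]
        simp⟩
      add_mem' := by
        rintro v w ⟨hv, hv'⟩ ⟨hw, hw'⟩
        refine ⟨Submodule.add_mem _ hv hw, ?_⟩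
        change (Function.support ((v.fst + w.fst : Lp ℂ 2 μ) : X → ℂ)).Finite
        rw [coe_add]
        exact (hv'.union hw').subset (Function.support_add _ _)
      smul_mem' := by
        rintro a v ⟨hv, hv'⟩
        refine ⟨Submodule.smul_mem _ a hv, ?_⟩
        change (Function.support ((a • v.fst : Lp ℂ 2 μ) : X → ℂ)).Finite
        rw [coe_smul]
        exact hv'.subset (Function.support_const_smul_subset a _) }

variable {G μ}

theorem mem_formSpace_iff_closure {v : WithLp 2 (Lp ℂ 2 μ × lp (fun _ : X × X => ℂ) 2)} :
    v ∈ G.formSpace μ ↔ ∀ ε : ℝ≥0∞, 0 < ε →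
      ∃ w ∈ G.gradGraph μ, (Function.support w.fst).Finite ∧ ‖v - w‖ₑ ^ 2 < ε := by
  rw [formSpace, ← SetLike.mem_coe, Submodule.topologicalClosure_coe, EMetric.mem_closure_iff]
  constructor
  · intro h ε hε
    obtain ⟨w, ⟨hw, hw'⟩, hd⟩ := h (ε ^ (2⁻¹ : ℝ)) (ENNReal.rpow_pos_of_nonneg hε (by norm_num))
    refine ⟨w, hw, hw', ?_⟩
    rw [edist_eq_enorm_sub] at hd
    have := ENNReal.pow_lt_pow_left two_ne_zero hd
    rwa [← ENNReal.rpow_natCast (ε ^ (2⁻¹ : ℝ)), ← ENNReal.rpow_mul, Nat.cast_ofNat,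
      inv_mul_cancel₀ (by norm_num), ENNReal.rpow_one] at this
  · intro h ε hε
    obtain ⟨w, hw, hw', hd⟩ := h (ε ^ 2) (by positivity)
    refine ⟨w, ⟨hw, hw'⟩, ?_⟩
    rw [edist_eq_enorm_sub]
    exact (ENNReal.pow_lt_pow_left_iff two_ne_zero).1 hd

theorem enorm_sq_of_mem_gradGraph (hc : ∀ x, G.c x = 0)
    {v : WithLp 2 (Lp ℂ 2 μ × lp (fun _ : X × X => ℂ) 2)} (hv : v ∈ G.gradGraph μ) :
    ‖v‖ₑ ^ 2 = G.energy v.fst + ‖v.fst‖ₑ ^ 2 := by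
  rw [← enorm_sq_eq_energy hc hv, add_comm]
  have h : ‖v‖₊ ^ 2 = ‖v.fst‖₊ ^ 2 + ‖v.snd‖₊ ^ 2 := by
    rw [← NNReal.coe_inj]
    push_cast
    exact WithLp.prod_norm_sq_eq_of_L2 v
  simp only [enorm_eq_nnnorm]
  exact_mod_cast h

/-- With `fst_mem_dirichletDomain` this identifies the abstract `formSpace` with `dirichletDomain`.
-/
theorem exists_mem_formSpace (hc : ∀ x, G.c x = 0) {f : Lp ℂ 2 μ}
    (hf : f ∈ G.dirichletDomain μ) : ∃ v ∈ G.formSpace μ, v.fst = f := by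
  have hlift : ∀ g : Lp ℂ 2 μ, G.energy g < ⊤ → ∃ v ∈ G.gradGraph μ, v.fst = g := fun g hg =>
    ⟨WithLp.toLp 2 (g, ⟨G.grad g, memℓp_grad hc hg⟩), rfl, rfl⟩
  obtain ⟨v, hv, rfl⟩ := hlift f hf.1
  refine ⟨v, mem_formSpace_iff_closure.2 fun ε hε => ?_, rfl⟩
  obtain ⟨g, hg, hd⟩ := hf.2 ε hε
  -- Finite energy of the approximant follows from `g = f - (f - g)`.
  have hgE : G.energy g < ⊤ := by
    have h1 : (g : X → ℂ) = (v.fst : X → ℂ) + (-1 : ℂ) • ((v.fst - g : Lp ℂ 2 μ) : X → ℂ) := by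
      rw [coe_sub]
      funext x
      simp
    rw [h1]
    refine (G.energy_add_le _ _).trans_lt (ENNReal.add_lt_top.2
      ⟨ENNReal.mul_lt_top (by simp) hf.1, ENNReal.mul_lt_top (by simp) ?_⟩)
    rw [energy_smul]
    exact ENNReal.mul_lt_top (by finiteness) (lt_top_of_lt (le_self_add.trans_lt hd))
  obtain ⟨w, hw, rfl⟩ := hlift g hgE
  refine ⟨w, hw, hg, ?_⟩
  rwa [enorm_sq_of_mem_gradGraph hc (Submodule.sub_mem _ hv hw)]

variable (G μ) in
/-- The embedding of the form domain into `ℓ²(X, μ)`. -/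
noncomputable def formEmbedding : G.formSpace μ →L[ℂ] Lp ℂ 2 μ :=
  (WithLp.fstL 2 ℂ _ _).comp (G.formSpace μ).subtypeL

theorem formEmbedding_apply (v : G.formSpace μ) : G.formEmbedding μ v = v.1.fst := rfl

variable [DiscreteMeasurableSpace X]

/-- This is closability of the form: being a gradient is a family of pointwise equations, and point
evaluations are continuous. Limits in `formSpace` are therefore still pairs of a function and its
gradient. -/
theorem isClosed_gradGraph : IsClosed (G.gradGraph μ : Set (WithLp 2 (Lp ℂ 2 μ ×
    lp (fun _ : X × X => ℂ) 2))) := by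
  have h : (G.gradGraph μ : Set (WithLp 2 (Lp ℂ 2 μ × lp (fun _ : X × X => ℂ) 2))) =
      ⋂ p : X × X, {v | lp.evalCLM ℂ (fun _ : X × X => ℂ) 2 p (WithLp.sndL 2 ℂ _ _ v) =
        (Real.sqrt (G.b p.1 p.2 / 2) : ℂ) *
          (evalCLM p.1 (WithLp.fstL 2 ℂ _ _ v) - evalCLM p.2 (WithLp.fstL 2 ℂ _ _ v))} := by
    ext v
    rw [Set.mem_iInter]
    exact funext_iff
  rw [h]
  exact isClosed_iInter fun p => isClosed_eq (by fun_prop) (by fun_prop)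

theorem mem_gradGraph_of_mem_formSpace {v : WithLp 2 (Lp ℂ 2 μ × lp (fun _ : X × X => ℂ) 2)}
    (hv : v ∈ G.formSpace μ) : v ∈ G.gradGraph μ := by
  refine Submodule.topologicalClosure_minimal _ ?_ isClosed_gradGraph hv
  exact fun w hw => hw.1

theorem fst_mem_dirichletDomain (hc : ∀ x, G.c x = 0)
    {v : WithLp 2 (Lp ℂ 2 μ × lp (fun _ : X × X => ℂ) 2)} (hv : v ∈ G.formSpace μ) :
    v.fst ∈ G.dirichletDomain μ := by
  have hvg := mem_gradGraph_of_mem_formSpace hv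
  refine ⟨?_, fun ε hε => ?_⟩
  · rw [← enorm_sq_eq_energy hc hvg]
    finiteness
  · obtain ⟨w, hw, hw', hd⟩ := mem_formSpace_iff_closure.1 hv ε hε
    refine ⟨w.fst, hw', ?_⟩
    rwa [enorm_sq_of_mem_gradGraph hc (Submodule.sub_mem _ hvg hw)] at hd

theorem pointIndicator_mem_dirichletDomain (x : X) :
    pointIndicator μ x ∈ G.dirichletDomain μ := by
  refine ⟨by rw [coe_pointIndicator]; exact G.energy_indicator_lt_top x,
    fun ε hε => ⟨pointIndicator μ x, ?_, ?_⟩⟩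
  · rw [coe_pointIndicator]
    exact (Set.finite_singleton x).subset Set.support_indicator_subset
  · rw [sub_self, coe_zero]
    simpa [energy] using hε

instance : CompleteSpace (G.formSpace μ) :=
  (Submodule.isClosed_topologicalClosure _).completeSpace_coe

variable (G μ) in
/-- The resolvent `(1 + L^(D))⁻¹` of the Dirichlet Laplacian. -/
noncomputable def dirichletResolvent : Lp ℂ 2 μ →L[ℂ] Lp ℂ 2 μ :=
  (G.formEmbedding μ).comp (ContinuousLinearMap.adjoint (G.formEmbedding μ))

/-- The range of the embedding contains all point indicators, so an `f` orthogonal to it vanishes at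
every point. -/
theorem adjoint_formEmbedding_injective (hc : ∀ x, G.c x = 0) {f : Lp ℂ 2 μ}
    (hf : ContinuousLinearMap.adjoint (G.formEmbedding μ) f = 0) : f = 0 := by
  refine Lp.ext (Eventually.of_forall fun x => ?_)
  obtain ⟨v, hv, hvx⟩ := exists_mem_formSpace hc
    (pointIndicator_mem_dirichletDomain (G := G) (μ := μ) x)
  have h : ⟪(⟨v, hv⟩ : G.formSpace μ), ContinuousLinearMap.adjoint (G.formEmbedding μ) f⟫_ℂ =
      ⟪pointIndicator μ x, f⟫_ℂ := by
    rw [ContinuousLinearMap.adjoint_inner_right, formEmbedding_apply, hvx]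
  rw [hf, inner_zero_right, inner_pointIndicator] at h
  have hx := (real_singleton_pos (μ := μ) x).ne'
  rw [coe_zero]
  simpa [hx] using h.symm

/-- The resolvent identity. -/
theorem dirichletResolvent_mem_graph (hc : ∀ x, G.c x = 0) (f : Lp ℂ 2 μ) :
    (G.dirichletResolvent μ f, f - G.dirichletResolvent μ f) ∈
      G.dirichletLaplacianGraph μ := by
  set v := ContinuousLinearMap.adjoint (G.formEmbedding μ) f with hv
  have hK : G.dirichletResolvent μ f = v.1.fst := rfl
  rw [hK]
  refine ⟨fst_mem_dirichletDomain hc v.2, fun h hh => ?_⟩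
  obtain ⟨u, hu, rfl⟩ := exists_mem_formSpace hc hh
  have h1 : ⟪(⟨u, hu⟩ : G.formSpace μ), v⟫_ℂ = ⟪u.fst, f⟫_ℂ := by
    rw [hv, ContinuousLinearMap.adjoint_inner_right, formEmbedding_apply]
  have h2 : ⟪(⟨u, hu⟩ : G.formSpace μ), v⟫_ℂ = ⟪u.fst, v.1.fst⟫_ℂ + ⟪u.snd, v.1.snd⟫_ℂ :=
    WithLp.prod_inner_apply u v.1
  rw [inner_eq_energyForm hc (mem_gradGraph_of_mem_formSpace hu)
    (mem_gradGraph_of_mem_formSpace v.2)] at h2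
  change G.energyForm u.fst v.1.fst = ⟪u.fst, f - v.1.fst⟫_ℂ
  rw [inner_sub_right, ← h1, h2]
  ring

/-- Here `κ = ‖J* f‖²` is nonzero because `J*` is injective. The resolvent identity puts `(κ f, (1 -
κ) f)` in the graph, and division by `κ` gives the eigenvalue `1/κ - 1`. -/
theorem mem_graph_of_dirichletResolvent_eq_smul (hc : ∀ x, G.c x = 0) {f : Lp ℂ 2 μ}
    (hf : ‖f‖ = 1) {κ : ℂ} (hκ : G.dirichletResolvent μ f = κ • f) :
    ∃ t : ℝ, (f, (t : ℂ) • f) ∈ G.dirichletLaplacianGraph μ := by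
  set v := ContinuousLinearMap.adjoint (G.formEmbedding μ) f with hv
  have h1 : κ = ((‖v‖ ^ 2 : ℝ) : ℂ) := (G.formEmbedding μ).eigenvalue_comp_adjoint hf hκ
  have hv0 : v ≠ 0 := fun h => by
    rw [adjoint_formEmbedding_injective hc h] at hf
    simp at hf
  have hκ0 : κ ≠ 0 := by
    rw [h1]
    simpa using hv0
  refine ⟨(‖v‖ ^ 2)⁻¹ - 1, ?_⟩
  have h2 := Submodule.smul_mem _ κ⁻¹ (dirichletResolvent_mem_graph hc f)
  rw [hκ] at h2
  convert h2 using 1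
  refine Prod.ext ?_ ?_
  · simp [smul_smul, hκ0]
  · rw [Prod.smul_snd, smul_sub, smul_smul, inv_mul_cancel₀ hκ0, h1, Complex.ofReal_sub, sub_smul]
    simp

/-! ### Compactness of the resolvent. -/

section Compact

variable (μ) in
/-- The truncation of a function to a finite set. -/
noncomputable def truncation (F : Finset X) : Lp ℂ 2 μ →L[ℂ] Lp ℂ 2 μ :=
  ∑ x ∈ F, (evalCLM x).smulRight (pointIndicator μ x)

theorem truncation_apply (F : Finset X) (f : Lp ℂ 2 μ) (y : X) [Decidable (y ∈ F)] :
    truncation μ F f y = if y ∈ F then f y else 0 := by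
  classical
  rw [truncation, sum_apply, coe_sum]
  simp only [ContinuousLinearMap.smulRight_apply, coe_smul, coe_pointIndicator, evalCLM_apply,
    Pi.smul_apply, smul_eq_mul, Set.indicator_apply, Set.mem_singleton_iff, mul_ite, mul_one,
    mul_zero, Finset.sum_ite_eq]
  congr

theorem isCompactOperator_truncation (F : Finset X) : IsCompactOperator (truncation μ F) :=
  ContinuousLinearMap.isCompactOperator_sum_smulRight F _ _

variable {C : ℝ≥0}

/-- The truncation error lives on the complement of `F` and is bounded by `‖f‖_∞`, which transience
controls by the form norm. -/
theorem SupNormBound.norm_sub_truncation_le [IsFiniteMeasure μ] (hC : G.SupNormBound C)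
    (hc : ∀ x, G.c x = 0) (F : Finset X) :
    ‖(truncation μ F).comp (G.formEmbedding μ) - G.formEmbedding μ‖ ≤
      Real.sqrt (μ.real (F : Set X)ᶜ * C) := by
  classical
  refine ContinuousLinearMap.opNorm_le_bound _ (Real.sqrt_nonneg _) fun v => ?_
  have hvD := fst_mem_dirichletDomain hc v.2
  set f : Lp ℂ 2 μ := v.1.fst with hf
  have hval : ∀ y, (truncation μ F f - f : Lp ℂ 2 μ) y = if y ∈ F then 0 else - f y := fun y => by
    rw [coe_sub, Pi.sub_apply, truncation_apply]
    split_ifs <;> simp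
  have h1 : ‖truncation μ F f - f‖ₑ ^ 2 ≤ μ (F : Set X)ᶜ * (C * ‖v‖ₑ ^ 2) := by
    refine (Lp.enorm_sq_le_of_support (s := (F : Set X)ᶜ) fun y hy => ?_).trans ?_
    · rw [hval, if_pos (by simpa using hy)]
    · gcongr
      calc (⨆ x, ‖(truncation μ F f - f : Lp ℂ 2 μ) x‖ₑ) ^ 2 ≤ (⨆ x, ‖f x‖ₑ) ^ 2 := by
            gcongr with y
            rw [hval]
            split_ifs <;> simp
        _ ≤ C * G.energy f := hC.iSup_enorm_sq_le hvD
        _ ≤ C * ‖v‖ₑ ^ 2 := by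
            gcongr
            have := enorm_sq_of_mem_gradGraph hc (mem_gradGraph_of_mem_formSpace v.2)
            change _ ≤ ‖v.1‖ₑ ^ 2
            rw [this]
            exact le_self_add
  have h2 := ENNReal.toReal_mono (by finiteness) h1
  simp only [ENNReal.toReal_mul, ENNReal.toReal_pow, toReal_enorm, ENNReal.coe_toReal] at h2
  change ‖truncation μ F f - f‖ ≤ _
  rw [← Real.sqrt_sq (norm_nonneg v), ← Real.sqrt_mul (by positivity)]
  refine Real.le_sqrt_of_sq_le (h2.trans (le_of_eq ?_))
  rw [measureReal_def]
  ring

theorem SupNormBound.isCompactOperator_dirichletResolvent [Countable X] [IsFiniteMeasure μ]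
    (hC : G.SupNormBound C) (hc : ∀ x, G.c x = 0) :
    IsCompactOperator (G.dirichletResolvent μ) := by
  have hr := ((tendsto_measureReal_compl_finset (μ := μ)).mul_const (C : ℝ)).sqrt
  rw [zero_mul, Real.sqrt_zero] at hr
  exact (ContinuousLinearMap.isCompactOperator_of_norm_sub_le (fun F =>
    (isCompactOperator_truncation F).comp_clm _) hr (hC.norm_sub_truncation_le hc)).comp_clm _

end Compact

end WeightedGraph

/-! ### Discreteness of the spectrum. -/

theorem HasPositivePointMasses.linearIndependent_pointIndicator {X : Type*} [MeasurableSpace X]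
    [DiscreteMeasurableSpace X] (μ : Measure X) [HasPositivePointMasses μ] :
    LinearIndependent ℂ (pointIndicator μ) := by
  refine linearIndependent_of_ne_zero_of_inner_eq_zero (fun x hx => ?_) fun x y hxy => ?_
  · have h := congrFun (coe_pointIndicator (μ := μ) x) x
    rw [hx, coe_zero] at h
    simp at h
  · change ⟪pointIndicator μ x, pointIndicator μ y⟫_ℂ = 0
    rw [inner_pointIndicator, coe_pointIndicator]
    simp [hxy]

theorem HilbertBasis.infinite_of_linearIndependent {H ι κ : Type*} [NormedAddCommGroup H]
    [InnerProductSpace ℂ H] (φ : HilbertBasis ι ℂ H) [Infinite κ] {v : κ → H}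
    (hv : LinearIndependent ℂ v) : Infinite ι := by
  by_contra h
  have := not_infinite_iff_finite.1 h
  have := Fintype.ofFinite ι
  have : FiniteDimensional ℂ H := φ.toOrthonormalBasis.toBasis.finiteDimensional_of_finite
  exact not_finite_iff_infinite.2 ‹Infinite κ› hv.finite_of_isNoetherian

theorem HilbertBasis.exists_reindex {H ι κ : Type*} [NormedAddCommGroup H]
    [InnerProductSpace ℂ H] [CompleteSpace H] (φ : HilbertBasis ι ℂ H) (e : κ ≃ ι) :
    ∃ ψ : HilbertBasis κ ℂ H, ∀ k, ψ k = φ (e k) := by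
  refine ⟨HilbertBasis.mk (φ.orthonormal.comp e e.injective) ?_, fun k => ?_⟩
  · rw [e.surjective.range_comp, φ.dense_span]
  · rw [HilbertBasis.coe_mk]
    rfl

namespace WeightedGraph

open HasPositivePointMasses

variable {X : Type*} [MeasurableSpace X] [DiscreteMeasurableSpace X] {G : WeightedGraph X}
  {μ : Measure X} [HasPositivePointMasses μ] {C : ℝ≥0}

theorem mem_dirichletLaplacianGraph_iff {f g : Lp ℂ 2 μ} :
    (f, g) ∈ G.dirichletLaplacianGraph μ ↔
      ∃ hf : f ∈ (G.dirichletLaplacian μ).domain, G.dirichletLaplacian μ ⟨f, hf⟩ = g := by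
  rw [← dirichletLaplacian_graph, LinearPMap.mem_graph_iff]
  exact ⟨fun ⟨⟨y, hy⟩, h1, h2⟩ => by subst h1; exact ⟨hy, h2⟩, fun ⟨hf, h⟩ => ⟨⟨f, hf⟩, rfl, h⟩⟩

/-- Orthonormal families of eigenfunctions have finitely many eigenvalues below any bound. -/
theorem SupNormBound.finite_setOf_eigenvalue_le [Countable X] [IsFiniteMeasure μ]
    (hC : G.SupNormBound C) {ι : Type*} {φ : ι → Lp ℂ 2 μ} (hφ : Orthonormal ℂ φ) {ev : ι → ℝ}
    (hev : ∀ i, (φ i, (ev i : ℂ) • φ i) ∈ G.dirichletLaplacianGraph μ) (t : ℝ) :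
    {i | ev i ≤ t}.Finite := by
  by_contra hinf
  -- Choose `F` with `C · max t 0 · μ(Fᶜ) < 1`. Then `#F + 1` eigenvalues below `t` contradict the
  -- eigenvalue bound. The maximum matches the truncation in `ENNReal.ofReal t`.
  have h := (tendsto_measureReal_compl_finset (μ := μ)).const_mul (C * max t 0 : ℝ)
  rw [mul_zero] at h
  obtain ⟨F, hF⟩ := (h.eventually_lt_const zero_lt_one).exists
  obtain ⟨s, hs, hcard⟩ := Set.Infinite.exists_subset_card_eq hinf (F.card + 1)
  have h1 := hC.one_le_of_orthonormal (φ := fun i : s => φ i) (ev := fun i : s => ev i)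
    (hφ.comp _ Subtype.val_injective) (fun i => hev i) (t := t) (fun i => hs i.2) F
    (by simp [hcard])
  have h2 := ENNReal.toReal_mono (by finiteness) h1
  simp only [ENNReal.toReal_mul, ENNReal.toReal_one, ENNReal.coe_toReal,
    ENNReal.toReal_ofReal'] at h2
  exact absurd h2 (not_le.2 hF)

/-- The Dirichlet Laplacian of a uniformly transient graph has purely discrete spectrum with
respect to any finite measure. -/
theorem SupNormBound.exists_isEigenvalueSequence [Countable X] [Infinite X] [IsFiniteMeasure μ]
    (hC : G.SupNormBound C) (hc : ∀ x, G.c x = 0) :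
    ∃ ev : ℕ → ℝ, IsEigenvalueSequence (G.dirichletLaplacian μ) ev := by
  obtain ⟨ι, φ, κ, hφ⟩ :=
    (hC.isCompactOperator_dirichletResolvent (μ := μ) hc).exists_hilbertBasis_eigenvectors
      (G.formEmbedding μ).isSymmetric_comp_adjoint
  choose v hv using fun i =>
    mem_graph_of_dirichletResolvent_eq_smul hc (φ.orthonormal.1 i) (hφ i)
  have hfin := hC.finite_setOf_eigenvalue_le φ.orthonormal hv
  have : Infinite ι := φ.infinite_of_linearIndependent (linearIndependent_pointIndicator μ)
  obtain ⟨e, he⟩ := exists_equiv_nat_monotone v hfin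
  obtain ⟨ψ, hψ⟩ := φ.exists_reindex e
  refine ⟨v ∘ e, he, ?_, ψ, fun k => mem_dirichletLaplacianGraph_iff.1 ?_⟩
  · refine tendsto_atTop.2 fun t => ?_
    rw [← Nat.cofinite_eq_atTop, eventually_cofinite]
    refine ((hfin t).preimage e.injective.injOn).subset fun k hk => ?_
    exact (not_le.1 hk).le
  · rw [hψ]
    exact hv (e k)

/-- Numbering starts at `0`, so `ev k` is the largest of the `k + 1` eigenvalues `ev 0, …, ev k`,
one more than `F` may have points. -/
theorem SupNormBound.one_le_eigenvalue (hC : G.SupNormBound C) {ev : ℕ → ℝ}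
    (hev : IsEigenvalueSequence (G.dirichletLaplacian μ) ev) {k : ℕ} {F : Finset X}
    (hF : F.card ≤ k) : 1 ≤ C * ENNReal.ofReal (ev k) * μ (F : Set X)ᶜ := by
  obtain ⟨φ, hφ⟩ := hev.exists_basis
  refine hC.one_le_of_orthonormal (φ := fun i : Fin (k + 1) => φ i)
    (ev := fun i : Fin (k + 1) => ev i)
    (φ.orthonormal.comp _ Fin.val_injective)
    (fun i => mem_dirichletLaplacianGraph_iff.2 (hφ i))
    (fun i => hev.monotone (Nat.lt_succ_iff.1 i.2)) F (by simpa using Nat.lt_succ_of_le hF)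

end WeightedGraph

/-! ### Measures with small tails, and arbitrarily fast eigenvalue growth. -/

/-- A strictly decreasing null sequence starting at `1` below prescribed positive bounds. -/
theorem exists_strictAnti_le (δ : ℕ → ℝ) (hδ : ∀ k, 0 < δ k) :
    ∃ t : ℕ → ℝ, t 0 = 1 ∧ StrictAnti t ∧ Tendsto t atTop (𝓝 0) ∧ ∀ k, t (k + 1) ≤ δ (k + 1) := by
  -- Halving ensures strict decrease and the limit `0`; the minimum ensures the bounds.
  let t : ℕ → ℝ := fun n => Nat.rec 1 (fun k s => min (s / 2) (δ (k + 1))) n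
  have hs : ∀ k, t (k + 1) = min (t k / 2) (δ (k + 1)) := fun k => rfl
  have hpos : ∀ k, 0 < t k := fun k => by
    induction k with
    | zero => exact one_pos
    | succ k ih => rw [hs]; exact lt_min (half_pos ih) (hδ _)
  have hle : ∀ k, t k ≤ (1 / 2) ^ k := fun k => by
    induction k with
    | zero => exact (pow_zero _).ge
    | succ k ih =>
      rw [hs, pow_succ]
      exact (min_le_left _ _).trans (by linarith)
  refine ⟨t, rfl, strictAnti_nat_of_succ_lt fun k => ?_, ?_, fun k => min_le_right _ _⟩
  · exact (min_le_left _ _).trans_lt (half_lt_self (hpos k))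
  · exact squeeze_zero (fun k => (hpos k).le) hle
      (tendsto_pow_atTop_nhds_zero_of_lt_one (by norm_num) (by norm_num))

/-- There are probability measures charging every point with prescribed decay of the tails. -/
theorem exists_isProbabilityMeasure_tail_le {X : Type*} [Countable X] [Infinite X]
    [MeasurableSpace X] [DiscreteMeasurableSpace X] (δ : ℕ → ℝ) (hδ : ∀ k, 0 < δ k) :
    ∃ (μ : Measure X) (_ : HasPositivePointMasses μ), IsProbabilityMeasure μ ∧
      ∃ F : ℕ → Finset X, ∀ k, (F k).card = k ∧
        (0 < k → μ (F k : Set X)ᶜ ≤ ENNReal.ofReal (δ k)) := by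
  classical
  obtain ⟨t, ht0, hanti, hlim, hle⟩ := exists_strictAnti_le δ hδ
  obtain ⟨_⟩ := nonempty_denumerable X
  let e : ℕ ≃ X := (Denumerable.eqv X).symm
  -- `t k` is to be the mass of the tail `e k, e (k+1), …`, so the point masses are its differences.
  -- For `k = 0` the tail is the whole space with mass `t 0 = 1`, hence no bound is imposed there.
  let w : ℕ → ℝ≥0∞ := fun n => ENNReal.ofReal (t n - t (n + 1))
  have hw : ∀ n, 0 < t n - t (n + 1) := fun n => sub_pos.2 (hanti (Nat.lt_succ_self n))
  have hsum : ∀ k, ∑ n ∈ Finset.range k, w n = ENNReal.ofReal (1 - t k) := fun k => by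
    rw [← ENNReal.ofReal_sum_of_nonneg fun n _ => (hw n).le, Finset.sum_range_sub', ht0]
  let μ : Measure X := Measure.sum fun n => w n • Measure.dirac (e n)
  have hμ : ∀ s : Set X, μ s = ∑' n, w n * s.indicator 1 (e n) := fun s => by
    rw [Measure.sum_apply _ MeasurableSet.of_discrete]
    exact tsum_congr fun n => by
      rw [Measure.smul_apply, Measure.dirac_apply' _ MeasurableSet.of_discrete, smul_eq_mul]
  have hprob : IsProbabilityMeasure μ := ⟨by
    rw [hμ]
    simp only [Set.indicator_univ, Pi.one_apply, mul_one]
    refine ENNReal.summable.hasSum_iff_tendsto_nat.2 ?_ |>.tsum_eq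
    simp only [hsum]
    have h1 := (ENNReal.continuous_ofReal.tendsto _).comp (hlim.const_sub 1)
    simpa [Function.comp_def] using h1⟩
  have hF : ∀ k, μ ((Finset.range k).map e.toEmbedding : Set X) = ENNReal.ofReal (1 - t k) :=
    fun k => by
      rw [hμ, ← hsum, tsum_eq_sum (s := Finset.range k)]
      · refine Finset.sum_congr rfl fun n hn => ?_
        rw [Set.indicator_of_mem (by simpa using hn)]
        simp
      · intro n hn
        rw [Set.indicator_of_notMem (by simpa using hn), mul_zero]
  refine ⟨μ, ⟨fun x => ?_, fun x => measure_lt_top μ _⟩, hprob,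
    fun k => (Finset.range k).map e.toEmbedding, fun k => ⟨by simp, fun hk => ?_⟩⟩
  · rw [hμ]
    refine lt_of_lt_of_le ?_ (ENNReal.le_tsum (e.symm x))
    simpa [w] using hw (e.symm x)
  · rw [prob_compl_eq_one_sub MeasurableSet.of_discrete, hF, ← ENNReal.ofReal_one,
      ← ENNReal.ofReal_sub _ (by rw [sub_nonneg, ← ht0]; exact hanti.antitone (Nat.zero_le k))]
    refine ENNReal.ofReal_le_ofReal ?_
    obtain ⟨j, rfl⟩ := Nat.exists_eq_succ_of_ne_zero hk.ne'
    simpa using hle j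

/-- On a uniformly transient graph the eigenvalues of the Dirichlet Laplacian can grow
arbitrarily fast. -/
theorem WeightedGraph.SupNormBound.exists_measure_tendsto {X : Type*} [Countable X] [Infinite X]
    [MeasurableSpace X] [DiscreteMeasurableSpace X] {G : WeightedGraph X} {C : ℝ≥0} (hC0 : 0 < C)
    (hC : G.SupNormBound C) (hc : ∀ x, G.c x = 0) (a : ℕ → ℝ) (ha : ∀ k, 0 < a k) :
    ∃ (μ : Measure X) (_ : HasPositivePointMasses μ), IsProbabilityMeasure μ ∧
      (∃ ev : ℕ → ℝ, IsEigenvalueSequence (G.dirichletLaplacian μ) ev) ∧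
      ∀ ev : ℕ → ℝ, IsEigenvalueSequence (G.dirichletLaplacian μ) ev →
        Tendsto (fun k => ev k / a k) atTop atTop := by
  have hC0' : (0 : ℝ) < C := hC0
  -- With tails at most `1 / (C (k + 1) a k)` the eigenvalue bound becomes `ev k ≥ (k + 1) a k`; the
  -- factor `k + 1` makes the ratio diverge.
  have hδ : ∀ k : ℕ, 0 < (C * (k + 1) * a k : ℝ)⁻¹ := fun k => by
    have := ha k
    positivity
  obtain ⟨μ, hμ, hprob, F, hF⟩ := exists_isProbabilityMeasure_tail_le (X := X) _ hδ
  refine ⟨μ, hμ, hprob, hC.exists_isEigenvalueSequence hc, fun ev hev => ?_⟩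
  refine tendsto_atTop_mono' atTop ?_ tendsto_natCast_atTop_atTop
  filter_upwards [eventually_gt_atTop 0] with k hk
  have h1 : 1 ≤ C * ENNReal.ofReal (ev k) * ENNReal.ofReal (C * (k + 1) * a k : ℝ)⁻¹ :=
    (hC.one_le_eigenvalue hev (hF k).1.le).trans (by gcongr; exact (hF k).2 hk)
  have h2 := ENNReal.toReal_mono (by finiteness) h1
  simp only [ENNReal.toReal_mul, ENNReal.toReal_one, ENNReal.coe_toReal,
    ENNReal.toReal_ofReal', max_eq_left (hδ k).le] at h2
  have hak := ha k
  rw [← div_eq_mul_inv, le_div_iff₀ (by positivity), one_mul, mul_assoc] at h2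
  have h3 := le_of_mul_le_mul_left h2 hC0'
  have h4 : (k + 1) * a k ≤ ev k := by
    rcases le_max_iff.1 h3 with h | h
    · exact h
    · exact absurd h (not_le.2 (by positivity))
  rw [le_div_iff₀ hak]
  nlinarith

theorem mainTheorem4 {X : Type*} [Countable X] [Infinite X]
    [MeasurableSpace X] [DiscreteMeasurableSpace X]
    (G : WeightedGraph X) (hc : ∀ x, G.c x = 0)
    (hconn : G.Connected) (htrans : G.IsUniformlyTransient) :
    (∀ a : ℕ → ℝ, (∀ k, 0 < a k) →
      ∃ (μ : Measure X) (_ : HasPositivePointMasses μ), IsProbabilityMeasure μ ∧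
        (∃ ev : ℕ → ℝ, IsEigenvalueSequence (G.dirichletLaplacian μ) ev) ∧
        ∀ ev : ℕ → ℝ, IsEigenvalueSequence (G.dirichletLaplacian μ) ev →
          Tendsto (fun k => ev k / a k) atTop atTop) ∧
    ¬ ∃ a : ℕ → ℝ, (∀ k, 0 < a k) ∧
      ∀ (μ : Measure X) (_ : HasPositivePointMasses μ), IsProbabilityMeasure μ →
        ∀ ev : ℕ → ℝ, IsEigenvalueSequence (G.dirichletLaplacian μ) ev →
          ev =O[atTop] a := by
  obtain ⟨C, hC0, hC⟩ := htrans
  have hgrowth := WeightedGraph.SupNormBound.exists_measure_tendsto (G := G) hC0 hC hc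
  refine ⟨hgrowth, ?_⟩
  rintro ⟨a, ha, hO⟩
  obtain ⟨μ, hμ, hprob, ⟨ev, hev⟩, hlim⟩ := hgrowth a ha
  -- A constant `K` in `ev = O(a)` would bound the ratios `ev k / a k`, which tend to infinity.
  obtain ⟨K, hK⟩ := (hO μ hμ hprob ev hev).bound
  obtain ⟨k, hk, hk'⟩ := (hK.and ((hlim ev hev).eventually_gt_atTop K)).exists
  rw [lt_div_iff₀ (ha k)] at hk'
  rw [Real.norm_eq_abs, Real.norm_eq_abs, abs_of_pos (ha k)] at hk
  exact absurd ((le_abs_self _).trans hk) (not_le.2 hk')
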